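/- \textbf{Definitions.} Recall that every $x\in(0,1]$ has a unique (infinite) classical Engel expansion $$x=\sum_{n=1}^{\infty}\frac{1}{p_1(x)\,p_2(x)\cdots p_n(x)},$$ where $p_1(x)\ge 2$ and $(p_n(x))_{n\ge1}$ is a non-decreasing sequence of natural numbers, and a unique modified Engel expansion $$x=\sum_{n=1}^{\infty}\frac{1}{(p'_1(x)-1)\cdots(p'_{n-1}(x)-1)\,p'_n(x)},$$ where $p'_1(x)\ge 2$ and $(p'_n(x))_{n\ge1}$ is a strictly increasing sequence of natural numbers. Both are cases of the positive Perron expansion $$x=\sum_{n=0}^{\infty}\frac{r_0r_1\cdots r_n}{(p_1-1)p_1\cdots(p_n-1)p_n\,p_{n+1}},\qquad p_{n+1}\ge r_n+1,$$ with $r_0=1$, and with $r_n=p_n-1$ (classical) or $r_n=p_n$ (modified) for $n\ge1$. Let $\mathcal T\colon(0,1]\to(0,1]$ send the number with classical Engel digits $(c_n)_{n\ge1}$ to the number with modified Engel digits $(c_n+n-1)_{n\ge1}$. Let $\psi\colon\mathbb N\to(0,\infty)$, where $\mathbb N=\{1,2,\dots\}$, be a positive function, and put $$\mathfrak A_\psi=\{x\in(0,1]\colon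 p_n(x)\ge\psi(n)\text{ for all sufficiently large }n\}.$$ Let $\dim_H$ denote the Hausdorff dimension. \textbf{Theorem (Fractal quasi-equivalence principle for Engel expansions).} If $\sum_{n=1}^\infty \frac{n}{\psi(n)}<\infty$, then the following hold. (1) For every set $E\subset\mathfrak A_\psi$, $\dim_H\mathcal T(E)=\dim_H E$. (2) Let $\mathfrak M\subset\mathbb N^{\mathbb N}$ be a set of sequences such that every $(a_n)_{n\ge1}\in\mathfrak M$ satisfies $a_n\ge\psi(n)$ for all sufficiently large $n$. Then $$\dim_H\{x\in(0,1]\colon (p_n(x))_{n\ge1}\in\mathfrak M\}=\dim_H\{x\in(0,1]\colon (p'_n(x)-n+1)_{n\ge1}\in\mathfrak M\}.$$ -/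

import Mathlib

open Set Filter MeasureTheory

noncomputable section

namespace Perron

/-!
Sequences of digits are indexed from `0`: for `c : ℕ → ℕ`, the value `c n` is the digit which is
usually written with the index `n + 1`. The numbers `r n` keep their usual index.
-/

/-- A sequence `P` of functions: the constant `P 0`, and `P n` a function of `n` variables. -/
abbrev System : Type := (n : ℕ) → (Fin n → ℕ) → ℕ

/-- The numbers `r_0 = φ_0` and `r_n = φ_n(c_1, …, c_n)`. -/
def r (P : System) (c : ℕ → ℕ) (n : ℕ) : ℕ := P n (fun i : Fin n => c i)

/-- The `n`-th term of the positive Perron series with digits `c`,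
`r_0 ⋯ r_n / ((c_1 - 1) c_1 ⋯ (c_n - 1) c_n c_{n+1})`. -/
def term (P : System) (c : ℕ → ℕ) (n : ℕ) : ℝ :=
  (∏ i ∈ Finset.range (n + 1), (r P c i : ℝ)) /
    ((∏ i ∈ Finset.range n, ((c i : ℝ) - 1) * (c i : ℝ)) * (c n : ℝ))

/-- The digits `c` are admissible: all `r_n` are positive and `c_{n+1} ≥ r_n + 1`. -/
def Admissible (P : System) (c : ℕ → ℕ) : Prop :=
  ∀ n, 1 ≤ r P c n ∧ r P c n + 1 ≤ c n

/-- `c` is the digit sequence of a `P`-representation of `x`. -/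
def IsRepresentation (P : System) (c : ℕ → ℕ) (x : ℝ) : Prop :=
  Admissible P c ∧ HasSum (term P c) x

/-- The number with `P`-digits `c`. -/
def value (P : System) (c : ℕ → ℕ) : ℝ := ∑' n, term P c n

open Classical in
/-- The sequence of `P`-digits of `x` (the zero sequence if `x` has no `P`-representation). -/
def digits (P : System) (x : ℝ) : ℕ → ℕ :=
  if h : ∃ c, IsRepresentation P c x then h.choose else 0

/-- The classical Engel expansion: `φ_0 = 1`, `φ_n(x_1, …, x_n) = x_n - 1`. -/
def engel : System
  | 0, _ => 1
  | n + 1, x => x (Fin.last n) - 1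

/-- The modified Engel expansion: `φ_0 = 1`, `φ_n(x_1, …, x_n) = x_n`. -/
def modEngel : System
  | 0, _ => 1
  | n + 1, x => x (Fin.last n)

/-- The map sending the number with Engel digits `c_n` to the number with modified Engel digits
`c_n + n - 1` (`n = 1, 2, …`). -/
def T (x : ℝ) : ℝ := value modEngel (fun n => digits engel x n + n)

/-- The numbers in `(0, 1]` whose `n`-th Engel digit is at least `ψ n` for all large `n`. -/
def growthSet (ψ : ℕ → ℝ) : Set ℝ :=
  {x | x ∈ Ioc (0 : ℝ) 1 ∧ ∀ᶠ n : ℕ in atTop, ψ (n + 1) ≤ (digits engel x n : ℝ)}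

end Perron

end

/-!
Both expansions are Perron series, and a Perron series locates its value between two monotone
sequences: the partial sums, which increase, and the right endpoints of the cylinders, which
decrease (`upper_sub_upper_succ`). If `c` and `d` first differ at the index `n`, with
`c n < d n`, then the difference of the values is the sum of three nonnegative quantities: the
distance from the value of `c` to the left end of its cylinder of order `n`, the gap between the two
cylinders of order `n`, and the distance from the value of `d` to the right end of its cylinder.
The first and the last are series of the nonnegative increments of the two monotone sequences.

Shifting Engel digits `c n` to modified Engel digits `c n + n` changes each of these
nonnegative terms by a bounded factor. In one direction the factor is always at most `2`, and in the
other it is controlled by `∑ (n + 1) / c n` (`weight_engel_le`). Comparing term by term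
(`value_sub_value_le`) shows that `T` is `2`-Lipschitz, and that its inverse is Lipschitz on
each set where `∑ (n + 1) / c n` is bounded. By the growth condition countably many of these sets
cover `growthSet ψ`, and Hausdorff dimension is countably stable, so `T` preserves it. The statement
on sets of digit sequences follows, since `T` maps the first set onto the second one.
-/

theorem sub_le_of_succ_sub_le {u v : ℕ → ℝ} {M : ℝ}
    (h : ∀ k, u (k + 1) - u k ≤ M * (v (k + 1) - v k)) {m n : ℕ} (hmn : n ≤ m) :
    u m - u n ≤ M * (v m - v n) := by
  induction m, hmn using Nat.le_induction with
  | base => simp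
  | succ k _ ih => linarith [h k]

/-- Comparing the increments of two convergent sequences compares their remainders. -/
theorem limit_sub_le_of_sub_le {u v : ℕ → ℝ} {M a b : ℝ}
    (h : ∀ k, u (k + 1) - u k ≤ M * (v (k + 1) - v k))
    (hu : Tendsto u atTop (nhds a)) (hv : Tendsto v atTop (nhds b)) (n : ℕ) :
    a - u n ≤ M * (b - v n) := by
  refine le_of_tendsto_of_tendsto (hu.sub_const (u n)) ((hv.sub_const (v n)).const_mul M) ?_
  filter_upwards [eventually_ge_atTop n] with m hm
  exact sub_le_of_succ_sub_le h hm

/-- A map whose inverse is Lipschitz on `s` does not lower the Hausdorff dimension of `s`. -/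
theorem dimH_le_dimH_image_of_dist_le {X Y : Type*} [MetricSpace X] [MetricSpace Y]
    {f : X → Y} {s : Set X} (C : NNReal)
    (h : ∀ x ∈ s, ∀ y ∈ s, dist x y ≤ C * dist (f x) (f y)) : dimH s ≤ dimH (f '' s) := by
  have hf : AntilipschitzWith C (s.domRestrict f) :=
    AntilipschitzWith.of_le_mul_dist fun x y => h x x.2 y y.2
  have h1 := hf.le_dimH_image (univ : Set s)
  have h2 : dimH (univ : Set s) = dimH s := by
    rw [← isometry_subtype_coe.dimH_image (univ : Set s)]
    simp
  rwa [h2, image_univ, Set.range_domRestrict] at h1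

namespace Perron

/-! ### Perron series and the endpoints of their cylinders -/

section General

variable {P Q : System} {c d c' d' : ℕ → ℕ} {n : ℕ}

/-- The factor `r_0 ⋯ r_n / ((c_1 - 1) c_1 ⋯ (c_n - 1) c_n)` of the `n`-th term of the Perron
series. It depends only on the first `n` digits. -/
noncomputable def weight (P : System) (c : ℕ → ℕ) (n : ℕ) : ℝ :=
  (∏ i ∈ Finset.range (n + 1), (r P c i : ℝ)) /
    ∏ i ∈ Finset.range n, ((c i : ℝ) - 1) * (c i : ℝ)

/-- The right endpoint of the cylinder of the digits `c 0, …, c n`: an upper bound of the numbers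
with these digits, approached when every later digit is the least admissible one. -/
noncomputable def upper (P : System) (c : ℕ → ℕ) (n : ℕ) : ℝ :=
  ∑ i ∈ Finset.range n, term P c i + weight P c n / ((c n : ℝ) - 1)

theorem term_eq (P : System) (c : ℕ → ℕ) (n : ℕ) : term P c n = weight P c n / c n := by
  rw [term, weight, div_div]

theorem weight_zero (P : System) (c : ℕ → ℕ) : weight P c 0 = r P c 0 := by simp [weight]

theorem weight_succ (P : System) (c : ℕ → ℕ) (n : ℕ) :
    weight P c (n + 1) = weight P c n * r P c (n + 1) / (((c n : ℝ) - 1) * c n) := by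
  rw [weight, weight, Finset.prod_range_succ _ (n + 1),
    Finset.prod_range_succ (fun i => ((c i : ℝ) - 1) * (c i : ℝ)) n, div_mul_eq_mul_div, div_div]

theorem r_congr (P : System) (h : ∀ i < n, c i = d i) : r P c n = r P d n := by
  unfold r
  congr 1
  ext i
  exact h i i.2

theorem weight_congr (P : System) (h : ∀ i < n, c i = d i) : weight P c n = weight P d n := by
  unfold weight
  congr 1
  · refine Finset.prod_congr rfl fun i hi => ?_
    rw [r_congr P fun j hj => h j (by have := Finset.mem_range.1 hi; omega)]
  · exact Finset.prod_congr rfl fun i hi => by rw [h i (Finset.mem_range.1 hi)]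

theorem sum_term_congr (P : System) (h : ∀ i < n, c i = d i) :
    ∑ i ∈ Finset.range n, term P c i = ∑ i ∈ Finset.range n, term P d i := by
  refine Finset.sum_congr rfl fun i hi => ?_
  have hi := Finset.mem_range.1 hi
  rw [term_eq, term_eq, h i hi, weight_congr P fun j hj => h j (hj.trans hi)]

theorem Admissible.two_le (h : Admissible P c) (n : ℕ) : (2 : ℝ) ≤ c n := by
  have := h n
  exact_mod_cast (by omega : 2 ≤ c n)

theorem Admissible.weight_pos (h : Admissible P c) (n : ℕ) : 0 < weight P c n := by
  refine div_pos (Finset.prod_pos fun i _ => ?_) (Finset.prod_pos fun i _ => ?_)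
  · exact_mod_cast (h i).1
  · have := h.two_le i
    nlinarith

theorem Admissible.term_pos (h : Admissible P c) (n : ℕ) : 0 < term P c n := by
  rw [term_eq]
  exact div_pos (h.weight_pos n) (by linarith [h.two_le n])

theorem upper_sub_upper_succ (h : Admissible P c) (n : ℕ) :
    upper P c n - upper P c (n + 1) = weight P c n / (((c n : ℝ) - 1) * c n) *
      (((c (n + 1) : ℝ) - 1 - r P c (n + 1)) / ((c (n + 1) : ℝ) - 1)) := by
  have h1 := h.two_le n
  have h2 := h.two_le (n + 1)
  have h3 : (c n : ℝ) ≠ 0 := by linarith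
  have h4 : (c n : ℝ) - 1 ≠ 0 := by linarith
  have h5 : (c (n + 1) : ℝ) - 1 ≠ 0 := by linarith
  rw [upper, upper, Finset.sum_range_succ, weight_succ, term_eq]
  field_simp
  ring

theorem Admissible.upper_antitone (h : Admissible P c) : Antitone (upper P c) := by
  refine antitone_nat_of_succ_le fun n => ?_
  have h1 := h.two_le n
  have h2 := h.two_le (n + 1)
  have h3 : (r P c (n + 1) : ℝ) + 1 ≤ c (n + 1) := by exact_mod_cast (h (n + 1)).2
  have h4 := upper_sub_upper_succ h n
  have h5 : 0 ≤ weight P c n / (((c n : ℝ) - 1) * c n) *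
      (((c (n + 1) : ℝ) - 1 - r P c (n + 1)) / ((c (n + 1) : ℝ) - 1)) :=
    mul_nonneg (div_nonneg (h.weight_pos n).le (by nlinarith))
      (div_nonneg (by linarith) (by linarith))
  linarith

theorem Admissible.sum_term_le_upper (h : Admissible P c) (n : ℕ) :
    ∑ i ∈ Finset.range n, term P c i ≤ upper P c n := by
  have : 0 ≤ weight P c n / ((c n : ℝ) - 1) :=
    div_nonneg (h.weight_pos n).le (by linarith [h.two_le n])
  rw [upper]
  linarith

theorem Admissible.hasSum_value (h : Admissible P c) : HasSum (term P c) (value P c) :=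
  (summable_of_sum_range_le (c := upper P c 0) (fun n => (h.term_pos n).le) fun n =>
    (h.sum_term_le_upper n).trans (h.upper_antitone n.zero_le)).hasSum

theorem Admissible.value_le_upper (h : Admissible P c) (n : ℕ) : value P c ≤ upper P c n := by
  refine le_of_tendsto h.hasSum_value.tendsto_sum_nat ?_
  filter_upwards [eventually_ge_atTop n] with m hm
  exact (h.sum_term_le_upper m).trans (h.upper_antitone hm)

theorem Admissible.sum_term_lt_value (h : Admissible P c) (n : ℕ) :
    ∑ i ∈ Finset.range n, term P c i < value P c := by
  have h1 := h.hasSum_value.summable.sum_le_tsum (Finset.range (n + 1))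
    fun i _ => (h.term_pos i).le
  rw [Finset.sum_range_succ] at h1
  exact lt_of_lt_of_le (by linarith [h.term_pos n]) h1

theorem Admissible.tendsto_upper (h : Admissible P c) :
    Tendsto (upper P c) atTop (nhds (value P c)) := by
  have h1 : Tendsto (fun n => ∑ i ∈ Finset.range n, term P c i + 2 * term P c n) atTop
      (nhds (value P c + 2 * 0)) :=
    h.hasSum_value.tendsto_sum_nat.add
      (h.hasSum_value.summable.tendsto_atTop_zero.const_mul 2)
  rw [mul_zero, add_zero] at h1
  refine tendsto_of_tendsto_of_tendsto_of_le_of_le tendsto_const_nhds h1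
    h.value_le_upper fun n => ?_
  have h2 := h.two_le n
  have h3 : weight P c n / ((c n : ℝ) - 1) ≤ 2 * term P c n := by
    rw [term_eq, div_le_iff₀ (by linarith)]
    have : 2 * (weight P c n / c n) * ((c n : ℝ) - 1) =
        weight P c n * (2 * ((c n : ℝ) - 1) / c n) := by ring
    rw [this]
    refine le_mul_of_one_le_right (h.weight_pos n).le ?_
    rw [le_div_iff₀ (by linarith)]
    linarith
  simpa [upper] using h3

theorem Admissible.value_mem_Ioc (h : Admissible P c) (h0 : r P c 0 = 1) :
    value P c ∈ Ioc (0 : ℝ) 1 := by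
  refine ⟨by simpa using h.sum_term_lt_value 0, (h.value_le_upper 0).trans ?_⟩
  have := h.two_le 0
  rw [upper, weight_zero, h0]
  simpa using inv_le_one_of_one_le₀ (by linarith : (1 : ℝ) ≤ (c 0 : ℝ) - 1)

/-- Two different sequences have a first index at which they differ. -/
theorem exists_first_ne (h : c ≠ d) : ∃ n, (∀ i < n, c i = d i) ∧ c n ≠ d n := by
  classical
  have h' : ∃ n, c n ≠ d n := Function.ne_iff.1 h
  exact ⟨Nat.find h', fun i hi => not_not.1 (Nat.find_min h' hi), Nat.find_spec h'⟩

/-- Perron series reverse the lexicographic order of digit sequences. -/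
theorem value_lt_value (hc : Admissible P c) (hd : Admissible P d)
    (h : ∀ i < n, c i = d i) (hn : c n < d n) : value P d < value P c := by
  refine lt_of_le_of_lt (hd.value_le_upper n) (lt_of_le_of_lt ?_ (hc.sum_term_lt_value (n + 1)))
  rw [Finset.sum_range_succ, upper, sum_term_congr P h, term_eq, weight_congr P h]
  have h1 : (c n : ℝ) + 1 ≤ d n := by exact_mod_cast hn
  have := hc.two_le n
  gcongr
  · exact (hd.weight_pos n).le
  · linarith

theorem value_injective (hc : Admissible P c) (hd : Admissible P d)
    (h : value P c = value P d) : c = d := by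
  by_contra hne
  obtain ⟨n, h1, h2⟩ := exists_first_ne hne
  rcases h2.lt_or_gt with h2 | h2
  · exact (value_lt_value hc hd h1 h2).ne' h
  · exact (value_lt_value hd hc (fun i hi => (h1 i hi).symm) h2).ne h

theorem digits_value (hc : Admissible P c) : digits P (value P c) = c := by
  have h : ∃ d, IsRepresentation P d (value P c) := ⟨c, hc, hc.hasSum_value⟩
  rw [digits, dif_pos h]
  exact value_injective h.choose_spec.1 hc h.choose_spec.2.tsum_eq

theorem isRepresentation_digits {x : ℝ} (h : digits P x ≠ 0) :
    IsRepresentation P (digits P x) x := by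
  by_cases hx : ∃ c, IsRepresentation P c x
  · rw [digits, dif_pos hx]
    exact hx.choose_spec
  · exact absurd (by rw [digits, dif_neg hx]) h

/-! ### Comparison of two Perron series -/

/-- The difference of two values of the system `Q` is compared with that of two values of the
system `P` by comparing separately the partial sums, the gap between the two cylinders, and the
right endpoints of the cylinders. -/
theorem value_sub_value_le {M : ℝ} (hc : Admissible P c) (hd : Admissible P d)
    (hc' : Admissible Q c') (hd' : Admissible Q d')
    (h : ∀ i < n, c i = d i) (h' : ∀ i < n, c' i = d' i)
    (hterm : ∀ k, term Q c' k ≤ M * term P c k)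
    (hgap : weight Q c' n * (1 / (c' n : ℝ) - 1 / ((d' n : ℝ) - 1)) ≤
      M * (weight P c n * (1 / (c n : ℝ) - 1 / ((d n : ℝ) - 1))))
    (hupper : ∀ k, upper Q d' k - upper Q d' (k + 1) ≤
      M * (upper P d k - upper P d (k + 1))) :
    value Q c' - value Q d' ≤ M * (value P c - value P d) := by
  have h1 := limit_sub_le_of_sub_le (M := M)
    (by simpa [Finset.sum_range_succ] using hterm) hc'.hasSum_value.tendsto_sum_nat
    hc.hasSum_value.tendsto_sum_nat (n + 1)
  have h2 := limit_sub_le_of_sub_le (M := M) (fun k => by linarith [hupper k])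
    hd'.tendsto_upper.neg hd.tendsto_upper.neg n
  rw [Finset.sum_range_succ, Finset.sum_range_succ, term_eq, term_eq] at h1
  rw [upper, upper, ← sum_term_congr Q h', ← sum_term_congr P h, ← weight_congr Q h',
    ← weight_congr P h] at h2
  simp only [mul_sub, mul_one_div] at hgap
  linarith

end General

/-! ### The two Engel expansions -/

section Engel

variable {c d : ℕ → ℕ} {n : ℕ} {K : ℝ}

theorem r_engel_succ (c : ℕ → ℕ) (n : ℕ) : r engel c (n + 1) = c n - 1 := rfl

theorem r_modEngel_succ (c : ℕ → ℕ) (n : ℕ) : r modEngel c (n + 1) = c n := rfl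

theorem admissible_engel_iff : Admissible engel c ↔ 2 ≤ c 0 ∧ ∀ n, c n ≤ c (n + 1) := by
  constructor
  · intro h
    refine ⟨(h 0).2, fun n => ?_⟩
    have := h (n + 1)
    rw [r_engel_succ] at this
    omega
  · rintro ⟨h0, h1⟩ n
    have h2 : ∀ n, 2 ≤ c n := fun n => h0.trans (monotone_nat_of_le_succ h1 n.zero_le)
    cases n with
    | zero => exact ⟨le_rfl, h0⟩
    | succ n =>
      rw [r_engel_succ]
      have := h2 n
      have := h1 n
      omega

theorem admissible_modEngel_iff :
    Admissible modEngel c ↔ 2 ≤ c 0 ∧ ∀ n, c n + 1 ≤ c (n + 1) := by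
  constructor
  · exact fun h => ⟨(h 0).2, fun n => (h (n + 1)).2⟩
  · rintro ⟨h0, h1⟩ n
    cases n with
    | zero => exact ⟨le_rfl, h0⟩
    | succ n =>
      have h2 : c 0 ≤ c n := monotone_nat_of_le_succ (fun k => by linarith [h1 k]) n.zero_le
      exact ⟨by rw [r_modEngel_succ]; omega, h1 n⟩

theorem admissible_modEngel_add_iff :
    Admissible modEngel (fun n => c n + n) ↔ Admissible engel c := by
  rw [admissible_engel_iff, admissible_modEngel_iff]
  refine and_congr Iff.rfl (forall_congr' fun n => ?_)
  omega

theorem weight_engel_succ (hc : Admissible engel c) (n : ℕ) :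
    weight engel c (n + 1) = weight engel c n / c n := by
  have h := hc.two_le n
  have h1 : (c n : ℝ) - 1 ≠ 0 := by linarith
  have h2 : 1 ≤ c n := by exact_mod_cast (by linarith : (1 : ℝ) ≤ c n)
  rw [weight_succ, r_engel_succ, Nat.cast_sub h2, Nat.cast_one]
  field_simp

theorem weight_modEngel_succ (hc : Admissible modEngel c) (n : ℕ) :
    weight modEngel c (n + 1) = weight modEngel c n / ((c n : ℝ) - 1) := by
  have h := hc.two_le n
  have h1 : (c n : ℝ) ≠ 0 := by linarith
  rw [weight_succ, r_modEngel_succ]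
  field_simp

theorem upper_engel_sub_succ (hc : Admissible engel c) (n : ℕ) :
    upper engel c n - upper engel c (n + 1) =
      weight engel c n * ((c (n + 1) : ℝ) - c n) *
        (1 / (((c n : ℝ) - 1) * c n * ((c (n + 1) : ℝ) - 1))) := by
  have h2 : 1 ≤ c n := by exact_mod_cast (by linarith [hc.two_le n] : (1 : ℝ) ≤ c n)
  rw [upper_sub_upper_succ hc, r_engel_succ, Nat.cast_sub h2, Nat.cast_one, div_mul_div_comm,
    mul_one_div]
  congr 2
  ring

theorem upper_modEngel_add_sub_succ (hc : Admissible modEngel (fun n => c n + n)) (n : ℕ) :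
    upper modEngel (fun n => c n + n) n - upper modEngel (fun n => c n + n) (n + 1) =
      weight modEngel (fun n => c n + n) n * ((c (n + 1) : ℝ) - c n) *
        (1 / (((c n : ℝ) + n - 1) * (c n + n) * ((c (n + 1) : ℝ) + n))) := by
  rw [upper_sub_upper_succ hc, r_modEngel_succ, div_mul_div_comm, mul_one_div]
  push_cast
  congr 2 <;> ring

/-- Passing to the modified expansion increases the weights at most by the factor
`c 0 / (c 0 - 1) ≤ 2`, which comes from the first digit. -/
theorem weight_modEngel_add_le (hc : Admissible engel c) (n : ℕ) :
    weight modEngel (fun n => c n + n) n ≤ 2 * weight engel c n := by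
  have hc' := admissible_modEngel_add_iff.2 hc
  cases n with
  | zero =>
    rw [weight_zero, weight_zero]
    norm_num [r, engel, modEngel]
  | succ n =>
    induction n with
    | zero =>
      have h := hc.two_le 0
      rw [weight_engel_succ hc, weight_modEngel_succ hc', weight_zero, weight_zero]
      simp only [r, engel, modEngel, Nat.cast_one, add_zero]
      rw [mul_one_div, div_le_div_iff₀ (by linarith) (by linarith)]
      linarith
    | succ n ih =>
      have h := hc.two_le (n + 1)
      rw [weight_engel_succ hc, weight_modEngel_succ hc', ← mul_div_assoc]
      have h0 : (0 : ℝ) ≤ n := n.cast_nonneg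
      push_cast
      refine div_le_div₀ ?_ ih (by linarith) (by linarith)
      linarith [hc.weight_pos (n + 1)]

/-- Passing back from the modified expansion increases the weights by a factor controlled by
`∑ (i + 1) / c i`. -/
theorem weight_engel_le (hc : Admissible engel c) (n : ℕ) :
    weight engel c n ≤ Real.exp (∑ i ∈ Finset.range n, ((i : ℝ) + 1) / c i) *
      weight modEngel (fun n => c n + n) n := by
  have hc' := admissible_modEngel_add_iff.2 hc
  induction n with
  | zero =>
    rw [weight_zero, weight_zero]
    simp [r, engel, modEngel]
  | succ n ih =>
    have h := hc.two_le n
    have h0 : (0 : ℝ) ≤ n := n.cast_nonneg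
    have h1 : ((c n : ℝ) + n - 1) / c n ≤ Real.exp (((n : ℝ) + 1) / c n) := by
      refine le_trans ?_ (Real.add_one_le_exp _)
      rw [div_add_one (by linarith)]
      gcongr
      linarith
    have hw := hc'.weight_pos n
    rw [weight_engel_succ hc, weight_modEngel_succ hc', Finset.sum_range_succ, Real.exp_add]
    push_cast
    have h2 : (c n : ℝ) + n - 1 ≠ 0 := by linarith
    calc weight engel c n / c n
        ≤ Real.exp (∑ i ∈ Finset.range n, ((i : ℝ) + 1) / c i) *
          weight modEngel (fun n => c n + n) n / c n := by gcongr
      _ = Real.exp (∑ i ∈ Finset.range n, ((i : ℝ) + 1) / c i) * (((c n : ℝ) + n - 1) / c n) *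
          (weight modEngel (fun n => c n + n) n / ((c n : ℝ) + n - 1)) := by field_simp
      _ ≤ _ := by
        have : 0 ≤ weight modEngel (fun n => c n + n) n / ((c n : ℝ) + n - 1) :=
          div_nonneg hw.le (by linarith)
        gcongr

theorem value_modEngel_sub_le (hc : Admissible engel c) (hd : Admissible engel d)
    (h : ∀ i < n, c i = d i) (hn : c n < d n) :
    value modEngel (fun n => c n + n) - value modEngel (fun n => d n + n) ≤
      2 * (value engel c - value engel d) := by
  have hc' := admissible_modEngel_add_iff.2 hc
  have hd' := admissible_modEngel_add_iff.2 hd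
  refine value_sub_value_le hc hd hc' hd' h (fun i hi => by rw [h i hi]) (fun k => ?_) ?_
    fun k => ?_
  · rw [term_eq, term_eq, ← mul_div_assoc]
    have h0 : (0 : ℝ) ≤ k := k.cast_nonneg
    push_cast
    exact div_le_div₀ (by linarith [hc.weight_pos k]) (weight_modEngel_add_le hc k)
      (by linarith [hc.two_le k]) (by linarith)
  · rw [← mul_assoc]
    have h1 : (c n : ℝ) + 1 ≤ d n := by exact_mod_cast hn
    have h2 := hc.two_le n
    have h3 : (0 : ℝ) ≤ n := n.cast_nonneg
    push_cast
    rw [div_sub_div _ _ (by linarith) (by linarith), div_sub_div _ _ (by linarith) (by linarith)]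
    refine mul_le_mul (weight_modEngel_add_le hc n) ?_
      (div_nonneg (by linarith) (by nlinarith)) (by linarith [hc.weight_pos n])
    refine div_le_div₀ (by linarith) (by linarith) (by nlinarith) ?_
    exact mul_le_mul (by linarith) (by linarith) (by linarith) (by linarith)
  · rw [upper_modEngel_add_sub_succ hd', upper_engel_sub_succ hd, ← mul_assoc, ← mul_assoc]
    have h0 : (0 : ℝ) ≤ k := k.cast_nonneg
    have h1 := hd.two_le k
    have h2 : (d k : ℝ) ≤ d (k + 1) := by exact_mod_cast (admissible_engel_iff.1 hd).2 k
    have h4 := hd.weight_pos k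
    have h5 : 0 < ((d k : ℝ) - 1) * d k * ((d (k + 1) : ℝ) - 1) :=
      mul_pos (mul_pos (by linarith) (by linarith)) (by linarith)
    have h6 : ((d k : ℝ) - 1) * d k * ((d (k + 1) : ℝ) - 1) ≤
        ((d k : ℝ) + k - 1) * (d k + k) * ((d (k + 1) : ℝ) + k) := by
      have : ((d k : ℝ) - 1) * d k ≤ ((d k : ℝ) + k - 1) * (d k + k) :=
        mul_le_mul (by linarith) (by linarith) (by linarith) (by linarith)
      exact mul_le_mul this (by linarith) (by linarith) (by nlinarith)
    refine mul_le_mul ?_ (one_div_le_one_div_of_le h5 h6)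
      (one_div_nonneg.2 (h5.le.trans h6)) (mul_nonneg (by linarith) (by linarith))
    exact mul_le_mul_of_nonneg_right (weight_modEngel_add_le hd k) (by linarith)

/-- The sequences `c` with `∑ (i + 1) / c i ≤ K`. -/
def SumLe (K : ℝ) (c : ℕ → ℕ) : Prop :=
  ∀ n, ∑ i ∈ Finset.range n, ((i : ℝ) + 1) / c i ≤ K

theorem SumLe.nonneg (h : SumLe K c) : 0 ≤ K := by simpa using h 0

theorem SumLe.add_one_le (h : SumLe K c) (hc : Admissible engel c) (n : ℕ) :
    (n : ℝ) + 1 ≤ K * c n := by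
  have h1 := h (n + 1)
  rw [Finset.sum_range_succ] at h1
  have h2 : 0 ≤ ∑ i ∈ Finset.range n, ((i : ℝ) + 1) / c i :=
    Finset.sum_nonneg fun i _ => by positivity
  rw [← div_le_iff₀ (by linarith [hc.two_le n])]
  linarith

theorem SumLe.weight_engel_le (h : SumLe K c) (hc : Admissible engel c) (n : ℕ) :
    weight engel c n ≤ Real.exp K * weight modEngel (fun n => c n + n) n := by
  have := ((admissible_modEngel_add_iff.2 hc).weight_pos n).le
  refine (Perron.weight_engel_le hc n).trans ?_
  gcongr
  exact h n

/-- The Lipschitz constant of the inverse of `T` on the numbers whose Engel digits satisfy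
`SumLe K`: the weights contribute `exp K`, and each of at most three further factors of a
denominator contributes `1 + 2 * K`. -/
noncomputable def lipConst (K : ℝ) : ℝ := Real.exp K * (1 + 2 * K) ^ 3

theorem value_engel_sub_le (hc : Admissible engel c) (hd : Admissible engel d)
    (hcK : SumLe K c) (hdK : SumLe K d) (h : ∀ i < n, c i = d i) (hn : c n < d n) :
    value engel c - value engel d ≤
      lipConst K * (value modEngel (fun n => c n + n) - value modEngel (fun n => d n + n)) := by
  have hc' := admissible_modEngel_add_iff.2 hc
  have hd' := admissible_modEngel_add_iff.2 hd
  have hK := hcK.nonneg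
  set B := 1 + 2 * K with hB
  have hB1 : 1 ≤ B := by linarith
  -- `c k - 1 ≥ c k / 2` costs the factor `2` in `B`
  have key : ∀ {e : ℕ → ℕ}, Admissible engel e → SumLe K e → ∀ k,
      (e k : ℝ) + k ≤ B * ((e k : ℝ) - 1) := by
    intro e he heK k
    have h1 := heK.add_one_le he k
    have h2 := he.two_le k
    nlinarith
  refine value_sub_value_le hc' hd' hc hd (fun i hi => by rw [h i hi]) h (fun k => ?_) ?_
    fun k => ?_
  · rw [term_eq, term_eq]
    have h0 : (0 : ℝ) ≤ k := k.cast_nonneg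
    have h1 := hc.two_le k
    have h2 := key hc hcK k
    have hw := hc'.weight_pos k
    have h3 : 1 / (c k : ℝ) ≤ B ^ 3 * (1 / ((c k : ℝ) + k)) := by
      rw [mul_one_div, div_le_div_iff₀ (by linarith) (by linarith), one_mul]
      calc (c k : ℝ) + k ≤ B * c k := by nlinarith
        _ ≤ B ^ 3 * c k := by
          gcongr
          exact le_self_pow₀ hB1 (by norm_num)
    calc weight engel c k / c k = weight engel c k * (1 / c k) := by ring
      _ ≤ (Real.exp K * weight modEngel (fun n => c n + n) k) *
          (B ^ 3 * (1 / ((c k : ℝ) + k))) :=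
        mul_le_mul (hcK.weight_engel_le hc k) h3 (by positivity) (by positivity)
      _ = _ := by rw [lipConst]; push_cast; ring
  · have h1 : (c n : ℝ) + 1 ≤ d n := by exact_mod_cast hn
    have h2 := hc.two_le n
    have h3 : (0 : ℝ) ≤ n := n.cast_nonneg
    have h4 := key hc hcK n
    have h5 := key hd hdK n
    have hw := hc'.weight_pos n
    push_cast
    rw [div_sub_div _ _ (by linarith) (by linarith), div_sub_div _ _ (by linarith) (by linarith)]
    have h6 : (1 * ((d n : ℝ) - 1) - c n * 1) / (c n * ((d n : ℝ) - 1)) ≤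
        B ^ 3 * ((1 * ((d n : ℝ) + n - 1) - (c n + n) * 1) /
          ((c n + n) * ((d n : ℝ) + n - 1))) := by
      have e : 1 * ((d n : ℝ) + n - 1) - (c n + n) * 1 = 1 * ((d n : ℝ) - 1) - c n * 1 := by ring
      rw [e, ← mul_div_assoc, mul_comm (B ^ 3), mul_div_assoc, div_eq_mul_one_div]
      refine mul_le_mul_of_nonneg_left ?_ (by linarith)
      rw [div_le_div_iff₀ (mul_pos (by linarith) (by linarith))
        (mul_pos (by linarith) (by linarith)), one_mul]
      calc ((c n : ℝ) + n) * ((d n : ℝ) + n - 1) ≤ (B * c n) * (B * ((d n : ℝ) - 1)) :=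
            mul_le_mul (by nlinarith) (by linarith) (by linarith) (by nlinarith)
        _ = B ^ 2 * (c n * ((d n : ℝ) - 1)) := by ring
        _ ≤ B ^ 3 * (c n * ((d n : ℝ) - 1)) := by
          refine mul_le_mul_of_nonneg_right (pow_le_pow_right₀ hB1 (by norm_num)) ?_
          exact mul_nonneg (by linarith) (by linarith)
    calc _ ≤ (Real.exp K * weight modEngel (fun n => c n + n) n) * _ :=
          mul_le_mul (hcK.weight_engel_le hc n) h6
            (div_nonneg (by linarith) (mul_nonneg (by linarith) (by linarith))) (by positivity)
      _ = _ := by rw [lipConst]; ring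
  · rw [upper_modEngel_add_sub_succ hd', upper_engel_sub_succ hd]
    have h0 : (0 : ℝ) ≤ k := k.cast_nonneg
    have h1 := hd.two_le k
    have h2 : (d k : ℝ) ≤ d (k + 1) := by exact_mod_cast (admissible_engel_iff.1 hd).2 k
    have h3 := key hd hdK k
    have h4 := key hd hdK (k + 1)
    push_cast at h4
    have hw := hd'.weight_pos k
    have h5 : 1 / (((d k : ℝ) - 1) * d k * ((d (k + 1) : ℝ) - 1)) ≤
        B ^ 3 * (1 / (((d k : ℝ) + k - 1) * (d k + k) * ((d (k + 1) : ℝ) + k))) := by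
      rw [mul_one_div, div_le_div_iff₀
        (mul_pos (mul_pos (by linarith) (by linarith)) (by linarith))
        (mul_pos (mul_pos (by linarith) (by linarith)) (by linarith)), one_mul]
      have h6 : ((d k : ℝ) + k - 1) * (d k + k) ≤ (B * ((d k : ℝ) - 1)) * (B * d k) :=
        mul_le_mul (by linarith) (by nlinarith) (by linarith) (by nlinarith)
      calc ((d k : ℝ) + k - 1) * (d k + k) * ((d (k + 1) : ℝ) + k)
          ≤ (B * ((d k : ℝ) - 1)) * (B * d k) * (B * ((d (k + 1) : ℝ) - 1)) :=
            mul_le_mul h6 (by linarith) (by linarith)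
              (mul_nonneg (mul_nonneg (by linarith) (by linarith))
                (mul_nonneg (by linarith) (by linarith)))
        _ = _ := by ring
    calc _ ≤ (Real.exp K * weight modEngel (fun n => d n + n) k) * ((d (k + 1) : ℝ) - d k) *
          (B ^ 3 * (1 / (((d k : ℝ) + k - 1) * (d k + k) * ((d (k + 1) : ℝ) + k)))) := by
          refine mul_le_mul ?_ h5 (one_div_nonneg.2 ?_) ?_
          · exact mul_le_mul_of_nonneg_right (hdK.weight_engel_le hd k) (by linarith)
          · exact mul_nonneg (mul_nonneg (by linarith) (by linarith)) (by linarith)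
          · exact mul_nonneg (by positivity) (by linarith)
      _ = _ := by rw [lipConst]; ring

theorem dist_value_modEngel_le (hc : Admissible engel c) (hd : Admissible engel d) :
    dist (value modEngel fun n => c n + n) (value modEngel fun n => d n + n) ≤
      2 * dist (value engel c) (value engel d) := by
  rcases eq_or_ne c d with rfl | hne
  · simp
  obtain ⟨n, h1, h2⟩ := exists_first_ne hne
  wlog hlt : c n < d n generalizing c d
  · rw [dist_comm, dist_comm (value engel c)]
    exact this hd hc hne.symm (fun i hi => (h1 i hi).symm) h2.symm (by omega)
  have h3 := value_lt_value hc hd h1 hlt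
  have h4 := value_lt_value (admissible_modEngel_add_iff.2 hc)
    (admissible_modEngel_add_iff.2 hd) (n := n) (fun i hi => by rw [h1 i hi]) (by omega)
  rw [Real.dist_eq, Real.dist_eq, abs_of_pos (sub_pos.2 h3), abs_of_pos (sub_pos.2 h4)]
  exact value_modEngel_sub_le hc hd h1 hlt

theorem dist_value_engel_le (hc : Admissible engel c) (hd : Admissible engel d)
    (hcK : SumLe K c) (hdK : SumLe K d) :
    dist (value engel c) (value engel d) ≤
      lipConst K *
        dist (value modEngel fun n => c n + n) (value modEngel fun n => d n + n) := by
  rcases eq_or_ne c d with rfl | hne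
  · simp
  obtain ⟨n, h1, h2⟩ := exists_first_ne hne
  wlog hlt : c n < d n generalizing c d
  · rw [dist_comm, dist_comm (value modEngel _)]
    exact this hd hc hdK hcK hne.symm (fun i hi => (h1 i hi).symm) h2.symm (by omega)
  have h3 := value_lt_value hc hd h1 hlt
  have h4 := value_lt_value (admissible_modEngel_add_iff.2 hc)
    (admissible_modEngel_add_iff.2 hd) (n := n) (fun i hi => by rw [h1 i hi]) (by omega)
  rw [Real.dist_eq, Real.dist_eq, abs_of_pos (sub_pos.2 h3), abs_of_pos (sub_pos.2 h4)]
  exact value_engel_sub_le hc hd hcK hdK h1 hlt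

end Engel

/-! ### Hausdorff dimension -/

section Dimension

variable {ψ : ℕ → ℝ}

theorem ne_zero_of_eventually_le (hpos : ∀ n : ℕ, 0 < ψ (n + 1)) {c : ℕ → ℕ}
    (h : ∀ᶠ n : ℕ in atTop, ψ (n + 1) ≤ (c n : ℝ)) : c ≠ 0 := by
  rintro rfl
  obtain ⟨n, hn⟩ := h.exists
  simp only [Pi.zero_apply, Nat.cast_zero] at hn
  linarith [hpos n]

theorem exists_sumLe (hpos : ∀ n : ℕ, 0 < ψ (n + 1))
    (hsum : Summable fun n : ℕ => ((n : ℝ) + 1) / ψ (n + 1)) {c : ℕ → ℕ}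
    (h : ∀ᶠ n : ℕ in atTop, ψ (n + 1) ≤ (c n : ℝ)) : ∃ K : ℕ, SumLe K c := by
  have h1 : Summable fun n : ℕ => ((n : ℝ) + 1) / c n := by
    refine Summable.of_norm_bounded_eventually_nat hsum ?_
    filter_upwards [h] with n hn
    rw [Real.norm_of_nonneg (by positivity)]
    exact div_le_div_of_nonneg_left (by positivity) (hpos n) hn
  obtain ⟨K, hK⟩ := exists_nat_ge (∑' n : ℕ, ((n : ℝ) + 1) / c n)
  exact ⟨K, fun n => (h1.sum_le_tsum _ fun i _ => by positivity).trans hK⟩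

theorem dimH_image_T (hpos : ∀ n : ℕ, 0 < ψ (n + 1))
    (hsum : Summable fun n : ℕ => ((n : ℝ) + 1) / ψ (n + 1)) {E : Set ℝ}
    (hE : E ⊆ growthSet ψ) : dimH (T '' E) = dimH E := by
  have hrep : ∀ x ∈ E, Admissible engel (digits engel x) ∧ value engel (digits engel x) = x := by
    intro x hx
    have := isRepresentation_digits (ne_zero_of_eventually_le hpos (hE hx).2)
    exact ⟨this.1, this.2.tsum_eq⟩
  apply le_antisymm
  · have hT : LipschitzOnWith 2 T E := LipschitzOnWith.of_dist_le_mul fun x hx y hy => by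
      have := dist_value_modEngel_le (hrep x hx).1 (hrep y hy).1
      rwa [(hrep x hx).2, (hrep y hy).2] at this
    exact hT.dimH_image_le
  · have hU : E = ⋃ K : ℕ, {x ∈ E | SumLe K (digits engel x)} := by
      ext x
      simp only [mem_iUnion, mem_ofPred_eq, exists_and_left, iff_self_and]
      exact fun hx => exists_sumLe hpos hsum (hE hx).2
    conv_lhs => rw [hU, dimH_iUnion]
    refine iSup_le fun K => le_trans ?_ (dimH_mono (image_mono
      (sep_subset E fun x => SumLe K (digits engel x))))
    refine dimH_le_dimH_image_of_dist_le (lipConst K).toNNReal fun x hx y hy => ?_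
    have := dist_value_engel_le (hrep x hx.1).1 (hrep y hy.1).1 hx.2 hy.2
    rw [(hrep x hx.1).2, (hrep y hy.1).2] at this
    rwa [Real.coe_toNNReal _ (by unfold lipConst; positivity)]

/-- `T` maps the numbers with Engel digits in `M` onto those whose modified Engel digits lie in
the correspondingly shifted set. -/
theorem image_T_digits_mem {M : Set (ℕ → ℕ)} (hM : ∀ a ∈ M, a ≠ 0) :
    T '' {x : ℝ | x ∈ Ioc (0 : ℝ) 1 ∧ digits engel x ∈ M} =
      {x : ℝ | x ∈ Ioc (0 : ℝ) 1 ∧ ∃ a ∈ M, ∀ n : ℕ,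
        (a n : ℤ) = (digits modEngel x n : ℤ) - (n : ℤ)} := by
  ext y
  constructor
  · rintro ⟨x, ⟨-, hxM⟩, rfl⟩
    have hc := admissible_modEngel_add_iff.2 (isRepresentation_digits (hM _ hxM)).1
    refine ⟨hc.value_mem_Ioc rfl, digits engel x, hxM, fun n => ?_⟩
    rw [T, digits_value hc]
    push_cast
    ring
  · rintro ⟨-, a, haM, ha⟩
    have hD : digits modEngel y = fun n => a n + n := by
      ext n
      have := ha n
      omega
    have hne : digits modEngel y ≠ 0 := by
      intro h0
      refine hM a haM (funext fun n => ?_)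
      have := congrFun (hD.symm.trans h0) n
      simp only [Pi.zero_apply] at this ⊢
      omega
    have hy := isRepresentation_digits hne
    rw [hD] at hy
    have hc := admissible_modEngel_add_iff.1 hy.1
    refine ⟨value engel a, ⟨hc.value_mem_Ioc rfl, by rwa [digits_value hc]⟩, ?_⟩
    rw [T, digits_value hc]
    exact hy.2.tsum_eq

end Dimension

end Perron

theorem mainTheorem2 (ψ : ℕ → ℝ) (hpos : ∀ n : ℕ, 0 < ψ (n + 1))
    (hsum : Summable fun n : ℕ => ((n : ℝ) + 1) / ψ (n + 1)) :
    (∀ E : Set ℝ, E ⊆ Perron.growthSet ψ → dimH (Perron.T '' E) = dimH E) ∧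
    (∀ M : Set (ℕ → ℕ),
      (∀ a ∈ M, ∀ᶠ n : ℕ in atTop, ψ (n + 1) ≤ (a n : ℝ)) →
      dimH {x : ℝ | x ∈ Ioc (0 : ℝ) 1 ∧ Perron.digits Perron.engel x ∈ M} =
        dimH {x : ℝ | x ∈ Ioc (0 : ℝ) 1 ∧ ∃ a ∈ M, ∀ n : ℕ,
          (a n : ℤ) = (Perron.digits Perron.modEngel x n : ℤ) - (n : ℤ)}) := by
  refine ⟨fun E hE => Perron.dimH_image_T hpos hsum hE, fun M hM => ?_⟩
  rw [← Perron.image_T_digits_mem fun a ha => Perron.ne_zero_of_eventually_le hpos (hM a ha)]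
  exact (Perron.dimH_image_T hpos hsum fun x hx => ⟨hx.1, hM _ hx.2⟩).symm
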